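/- Let $\mathcal X=\mathcal X^1\times\mathcal X^2$ be a finite product space and let $X=(X^1,X^2)$ be a càdlàg $\mathcal X$-valued process on a probability space $(\Omega,\mathcal F,\mathbb P)$ which is a Markov chain (in its own filtration, with any initial law) with infinitesimal generator $\Lambda(t)=[\lambda^{x}_{y}(t)]_{x,y\in\mathcal X}$, $t\ge 0$. Here a generator is a matrix function on $[0,\infty)$ with locally integrable entries, nonnegative off the diagonal and with zero row sums, and it is the generator of a Markov chain if the transition probabilities of the chain satisfy the Kolmogorov forward equation $P(s,t)=I+\int_s^tP(s,r)\Lambda(r)\,dr$, $0\le s\le t$ (in the rows of states of positive probability at time $s$). Fix $i\in\{1,2\}$ and let $j$ be the other index. Let $\mathcal F^{X^i}_t=\sigma(X^i_s:0\le s\le t)$. We say that $X$ is weakly Markovian consistent with respect to $X^i$ if $\mathbb P(X^i_{t+s}\in B\mid\mathcal F^{X^i}_t)=\mathbb P(X^i_{t+s}\in B\mid X^i_t)$ a.s. for all $s,t\ge0$ and all measurable $B$. For $f:\mathcal X\to\mathbb R$ and $f^i:\mathcal X^i\to\mathbb R$ put $$(Q^i_tf)(x^i)=\mathbb E\big(f(X_t)\mid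 X^i_t=x^i\big)\quad\text{if }\mathbb P(X^i_t=x^i)>0,\qquad (C^{i,*}f^i)(x^1,x^2)=f^i(x^i).$$ For a matrix function $\Lambda^i(t)=[\lambda^i_{x^iy^i}(t)]_{x^i,y^i\in\mathcal X^i}$ with $\lambda^i_{x^ix^i}=-\sum_{y^i\ne x^i}\lambda^i_{x^iy^i}$ consider the conditions (15) for all $x^i\neq y^i$ in $\mathcal X^i$, $dt\otimes d\mathbb P$-a.s., $$\mathbf 1_{\{X^i_t=x^i\}}\sum_{x^j,y^j\in\mathcal X^j}\lambda^{x^1x^2}_{y^1y^2}(t)\,\mathbb P(X^j_t=x^j\mid\mathcal F^{X^i}_t)=\mathbf 1_{\{X^i_t=x^i\}}\lambda^i_{x^iy^i}(t);$$ (16) the same with $\mathbb P(X^j_t=x^j\mid\mathcal F^{X^i}_t)$ replaced by $\mathbb P(X^j_t=x^j\mid X^i_t=x^i)$; (23) $Q^i_t\,\Lambda(t)\,C^{i,*}=\Lambda^i(t)$, meaning that $(Q^i_t\Lambda(t)C^{i,*}g)(x^i)=(\Lambda^i(t)g)(x^i)$ for every $g:\mathcal X^i\to\mathbb R$ and every $x^i$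 with $\mathbb P(X^i_t=x^i)>0$. **Theorem 1.3.** (a) Condition (23) is necessary for weak Markovian consistency. That is, suppose that $X$ is weakly Markovian consistent with respect to $X^i$. Then there is a generator $\Lambda^i$ of the Markov chain $X^i$ (in its own filtration) which satisfies (15) and satisfies (23) for every $t\ge0$. Moreover, every matrix function $\Lambda^i$ as above satisfying (15), and every generator $\Lambda^i$ of $X^i$, satisfies (23) for almost every $t\ge0$. (b) For every matrix function $\Lambda^i$ as above (whether or not $X$ is weakly Markovian consistent), condition (16) holds if and only if (23) holds for almost every $t\ge0$. -/

import Mathlib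

open MeasureTheory ProbabilityTheory Filter Topology
open scoped Matrix

noncomputable section

namespace MarkovConsistency

/-- The real-valued indicator function of an event. -/
def ind {Ω : Type*} (A : Set Ω) : Ω → ℝ := A.indicator (fun _ => 1)

/-- The filtration generated by a process on `[0, ∞)`: at time `t` it is `σ(V s : 0 ≤ s ≤ t)`.
Time is a real number and only times `t ≥ 0` are ever used. -/
@[reducible] def history {Ω E : Type*} [MeasurableSpace E] (V : ℝ → Ω → E) (t : ℝ) : MeasurableSpace Ω :=
  ⨆ s ∈ Set.Icc (0 : ℝ) t, MeasurableSpace.comap (V s) inferInstance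

/-- The Markov property of a process with respect to its own filtration:
`P(V (t + s) ∈ B | F_t) = P(V (t + s) ∈ B | V t)` almost surely. -/
def IsMarkovInOwnFiltration {Ω E : Type*} [MeasurableSpace Ω] [MeasurableSpace E]
    (μ : Measure Ω) (V : ℝ → Ω → E) : Prop :=
  ∀ t s : ℝ, 0 ≤ t → 0 ≤ s → ∀ B : Set E, MeasurableSet B →
    condExp (history V t) μ (ind (V (t + s) ⁻¹' B)) =ᵐ[μ]
      condExp (MeasurableSpace.comap (V t) inferInstance) μ (ind (V (t + s) ⁻¹' B))

/-- All paths on `[0, ∞)` are càdlàg, for the discrete topology on the (finite) state space. -/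
def IsCadlag {Ω E : Type*} (V : ℝ → Ω → E) : Prop :=
  ∀ ω : Ω, ∀ t : ℝ, 0 ≤ t →
    (∀ᶠ s in 𝓝[>] t, V s ω = V t ω) ∧
    (0 < t → ∃ v : E, ∀ᶠ s in 𝓝[<] t, V s ω = v)

/-- The diagonal of a matrix function is given, for `t ≥ 0`, by minus the sum of the off-diagonal
entries in the row. -/
def HasGeneratorDiagonal {E : Type*} [Fintype E] [DecidableEq E] (L : ℝ → Matrix E E ℝ) : Prop :=
  ∀ t : ℝ, 0 ≤ t → ∀ v : E, L t v v = -∑ w with w ≠ v, L t v w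

/-- Generator functions: matrix functions on `[0, ∞)` with locally integrable entries, nonnegative
off the diagonal, with rows summing to zero. The entry `L t v w` is the intensity of jumps from `v`
to `w` at time `t`. -/
structure IsGeneratorFunction {E : Type*} [Fintype E] [DecidableEq E]
    (L : ℝ → Matrix E E ℝ) : Prop where
  locallyIntegrable : ∀ v w : E, LocallyIntegrableOn (fun t => L t v w) (Set.Ici 0) volume
  nonneg : ∀ t : ℝ, 0 ≤ t → ∀ v w : E, v ≠ w → 0 ≤ L t v w
  diagonal : HasGeneratorDiagonal L

/-- The transition probability `P(V t = w | V s = v)`; meaningful when `P(V s = v) > 0`. -/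
def transProb {Ω E : Type*} [MeasurableSpace Ω] (μ : Measure Ω) (V : ℝ → Ω → E)
    (s t : ℝ) (v w : E) : ℝ :=
  (μ[|{ω | V s ω = v}]).real {ω | V t ω = w}

/-- `V` is a càdlàg finite-state Markov chain (with respect to its own filtration) with
infinitesimal generator `L`: its transition probabilities solve the Kolmogorov forward equation
`P(s,t) = I + ∫ₛᵗ P(s,r) L(r) dr`. -/
structure IsMarkovChainWithGenerator {Ω E : Type*} [MeasurableSpace Ω] [Fintype E] [DecidableEq E]
    [MeasurableSpace E] (μ : Measure Ω) (V : ℝ → Ω → E) (L : ℝ → Matrix E E ℝ) : Prop where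
  measurable : ∀ t : ℝ, 0 ≤ t → Measurable (V t)
  cadlag : IsCadlag V
  markov : IsMarkovInOwnFiltration μ V
  generator : IsGeneratorFunction L
  kolmogorov : ∀ s t : ℝ, 0 ≤ s → s ≤ t → ∀ v w : E, μ {ω | V s ω = v} ≠ 0 →
    transProb μ V s t v w =
      (1 : Matrix E E ℝ) v w + ∫ r in s..t, ∑ u, transProb μ V s r v u * L r u w

section Bivariate

/-! A bivariate process `X = (X 0, X 1)` takes values in the product of the two spaces `S 0`, `S 1`;
the components are indexed by `Fin 2`, and `1 - i` is the index of the other component. -/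

variable {Ω : Type*} {S : Fin 2 → Type*}

/-- The component `X^i` of a bivariate process. -/
def component (X : ℝ → Ω → (∀ k, S k)) (i : Fin 2) : ℝ → Ω → S i := fun t ω => X t ω i

/-- Weak Markovian consistency with respect to `X^i`: the component `X^i` is a Markov process in
its own filtration. -/
def WeaklyConsistent [MeasurableSpace Ω] [∀ k, MeasurableSpace (S k)] (μ : Measure Ω)
    (X : ℝ → Ω → (∀ k, S k)) (i : Fin 2) : Prop :=
  IsMarkovInOwnFiltration μ (component X i)

/-- The operator `Q^i_t`: `(Q^i_t f)(x) = E(f(X_t) | X^i_t = x)`; meaningful at the points `x` with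
`P(X^i_t = x) > 0`. -/
def Q [MeasurableSpace Ω] (μ : Measure Ω) (X : ℝ → Ω → (∀ k, S k)) (i : Fin 2) (t : ℝ)
    (f : (∀ k, S k) → ℝ) : S i → ℝ :=
  fun x => ∫ ω, f (X t ω) ∂(μ[|{ω | component X i t ω = x}])

/-- The extension operator `C^{i,*}` from functions on the `i`-th factor to functions on the
product. -/
def extension (i : Fin 2) (g : S i → ℝ) : (∀ k, S k) → ℝ := fun x => g (x i)

variable [∀ k, Fintype (S k)] [∀ k, DecidableEq (S k)]

/-- The operator identity `Q^i_t Λ(t) C^{i,*} = Λ^i(t)` at time `t`: both sides, applied to any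
function on the `i`-th factor, agree at every state `x` with `P(X^i_t = x) > 0`
(at the other states `E(· | X^i_t = x)` is undefined). -/
def OperatorIdentity [MeasurableSpace Ω] (μ : Measure Ω) (X : ℝ → Ω → (∀ k, S k))
    (L : ℝ → Matrix (∀ k, S k) (∀ k, S k) ℝ) (i : Fin 2) (Li : ℝ → Matrix (S i) (S i) ℝ)
    (t : ℝ) : Prop :=
  ∀ (g : S i → ℝ) (x : S i), μ {ω | component X i t ω = x} ≠ 0 →
    Q μ X i t (L t *ᵥ extension i g) x = (Li t *ᵥ g) x

/-- The off-diagonal entries of `Li` are the intensities of `X^i` given its history: for `x ≠ y`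
in the `i`-th factor, `dt ⊗ dP`-almost surely,
`1{X^i_t = x} ∑ λ^z_w(t) P(X^j_t = z^j | F^{X^i}_t) = 1{X^i_t = x} λ^i_{xy}(t)`,
where `j = 1 - i` is the other index and the sum is over the points `z`, `w` of the product with
`z^i = x` and `w^i = y`, that is, over their `j`-th coordinates. -/
def HistoryIntensity [MeasurableSpace Ω] [∀ k, MeasurableSpace (S k)] (μ : Measure Ω)
    (X : ℝ → Ω → (∀ k, S k)) (L : ℝ → Matrix (∀ k, S k) (∀ k, S k) ℝ) (i : Fin 2)
    (Li : ℝ → Matrix (S i) (S i) ℝ) : Prop :=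
  ∀ x y : S i, x ≠ y → ∀ᵐ t ∂(volume.restrict (Set.Ici (0 : ℝ))), ∀ᵐ ω ∂μ,
    ind {ω | component X i t ω = x} ω *
        ∑ z with z i = x, ∑ w with w i = y, L t z w *
          condExp (history (component X i) t) μ
            (ind {ω | component X (1 - i) t ω = z (1 - i)}) ω =
      ind {ω | component X i t ω = x} ω * Li t x y

/-- The same condition with conditioning on the present state only: for `x ≠ y`,
`dt ⊗ dP`-almost surely,
`1{X^i_t = x} ∑ λ^z_w(t) P(X^j_t = z^j | X^i_t = x) = 1{X^i_t = x} λ^i_{xy}(t)`. -/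
def StateIntensity [MeasurableSpace Ω] (μ : Measure Ω)
    (X : ℝ → Ω → (∀ k, S k)) (L : ℝ → Matrix (∀ k, S k) (∀ k, S k) ℝ) (i : Fin 2)
    (Li : ℝ → Matrix (S i) (S i) ℝ) : Prop :=
  ∀ x y : S i, x ≠ y → ∀ᵐ t ∂(volume.restrict (Set.Ici (0 : ℝ))), ∀ᵐ ω ∂μ,
    ind {ω | component X i t ω = x} ω *
        ∑ z with z i = x, ∑ w with w i = y, L t z w *
          (μ[|{ω | component X i t ω = x}]).real
            {ω | component X (1 - i) t ω = z (1 - i)} =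
      ind {ω | component X i t ω = x} ω * Li t x y

end Bivariate

end MarkovConsistency

end

noncomputable section

namespace MarkovConsistency

/-! Write `p_A(r, v) = P(A, X_r = v)`. For `A` in the history at `t`, the Markov property turns the
Kolmogorov equation into a forward equation for `p_A`. At a right Lebesgue point `t` of all entries
of `Λ`, hence at almost every `t`, its right derivative at `t` is `∑ u, p_A(t, u) Λ_{uw}(t)`.
Summing over the `w` with `w i = y` differentiates `P(A, X^i_r = y)`.

If `X^i` is Markov and `A` lies in its history, then on `r ≥ t` the function `P(A, X^i_t = x, X^i_r
= y)` is a constant multiple of `P(X^i_t = x, X^i_r = y)`. Comparing right derivatives at `t` shows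
that the mean jump rate from `x` to `y` on `A ∩ {X^i_t = x}` is independent of `A`; it is the entry
of `projectedGenerator` (`WeaklyConsistent.sum_jointProb_mul_componentRate`). This is the history
condition tested on events. Inserted into the integrated forward equation, it makes the projected
matrix a generator of `X^i`. Any other generator of `X^i` gives the same right derivatives almost
everywhere.

The rest is algebra: `Q Λ C` has matrix `projectedGenerator`, and so does the averaged intensity
given the present state (`stateIntensity_iff`). Integrating the history condition over `Ω` yields
the state condition. -/

/-! ### Right continuity and right Lebesgue points. -/

theorem measurable_of_rightContinuous {f : ℝ → ℝ}
    (hf : ∀ t, ContinuousWithinAt f (Set.Ioi t) t) : Measurable f := by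
  -- The approximants evaluate `f` at the first point of the grid `ℤ / (n + 1)` strictly to the
  -- right of `t`, so they factor through a map on `ℤ`.
  refine measurable_of_tendsto_metrizable
    (f := fun (n : ℕ) t => f (((⌊((n : ℝ) + 1) * t⌋ + 1 : ℤ) : ℝ) / ((n : ℝ) + 1))) ?_ ?_
  · intro n
    have h1 : Measurable fun k : ℤ => f (((k + 1 : ℤ) : ℝ) / ((n : ℝ) + 1)) :=
      measurable_from_top
    exact h1.comp (Int.measurable_floor.comp (measurable_const.mul measurable_id))
  · rw [tendsto_pi_nhds]
    intro t
    refine (hf t).tendsto.comp (tendsto_nhdsWithin_iff.2 ⟨?_, ?_⟩)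
    · have h2 : Tendsto (fun n : ℕ => t + 1 / ((n : ℝ) + 1)) atTop (𝓝 t) := by
        simpa using tendsto_const_nhds.add (tendsto_one_div_add_atTop_nhds_zero_nat (𝕜 := ℝ))
      refine tendsto_of_tendsto_of_tendsto_of_le_of_le tendsto_const_nhds h2 ?_ ?_
      · intro n
        have hn : (0 : ℝ) < n + 1 := by positivity
        simp only
        rw [le_div_iff₀ hn]
        push_cast
        linarith [Int.lt_floor_add_one (((n : ℝ) + 1) * t)]
      · intro n
        have hn : (0 : ℝ) < n + 1 := by positivity
        simp only
        rw [div_le_iff₀ hn, add_mul t, one_div, inv_mul_cancel₀ hn.ne']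
        push_cast
        linarith [Int.floor_le (((n : ℝ) + 1) * t)]
    · refine Eventually.of_forall fun n => ?_
      have hn : (0 : ℝ) < n + 1 := by positivity
      simp only [Set.mem_Ioi]
      rw [lt_div_iff₀ hn]
      push_cast
      linarith [Int.lt_floor_add_one (((n : ℝ) + 1) * t)]

/-- `t` is a right Lebesgue point of `g`. -/
def IsRightLebesguePoint (g : ℝ → ℝ) (t : ℝ) : Prop :=
  HasDerivWithinAt (fun u => ∫ r in t..u, |g r - g t|) 0 (Set.Ici t) t

/-- Lebesgue differentiation along the intervals `[t, u]`, which belong to the Vitali family at `t`.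
-/
theorem ae_isRightLebesguePoint {g : ℝ → ℝ} (hg : LocallyIntegrable g volume) :
    ∀ᵐ t, IsRightLebesguePoint g t := by
  filter_upwards [(IsUnifLocDoublingMeasure.vitaliFamily
    (volume : Measure ℝ) 1).ae_tendsto_average_norm_sub hg] with t ht
  have h := ht.comp (Real.tendsto_Icc_vitaliFamily_right t)
  rw [IsRightLebesguePoint, ← hasDerivWithinAt_Ioi_iff_Ici, hasDerivWithinAt_iff_tendsto_slope']
  · refine h.congr' ?_
    filter_upwards [self_mem_nhdsWithin] with u (hu : t < u)
    simp only [Function.comp, Real.norm_eq_abs]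
    rw [slope_def_field, setAverage_eq, intervalIntegral.integral_same, sub_zero,
      intervalIntegral.integral_of_le hu.le, ← integral_Icc_eq_integral_Ioc,
      Real.volume_real_Icc_of_le hu.le, smul_eq_mul, div_eq_inv_mul]
  · simp

theorem _root_.MeasureTheory.LocallyIntegrable.intervalIntegrable {g : ℝ → ℝ}
    (hg : LocallyIntegrable g volume) {a b : ℝ} : IntervalIntegrable g volume a b :=
  intervalIntegrable_iff.2
    ((hg.integrableOn_isCompact isCompact_uIcc).mono_set Set.uIoc_subset_uIcc)

theorem _root_.MeasureTheory.LocallyIntegrable.bounded_mul {φ g : ℝ → ℝ} {C : ℝ}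
    (hg : LocallyIntegrable g volume)
    (hφ : Measurable φ) (hC : ∀ r, |φ r| ≤ C) : LocallyIntegrable (fun r => φ r * g r) volume := by
  intro t
  obtain ⟨U, hU, hi⟩ := hg t
  exact ⟨U, hU, Integrable.bdd_mul hi hφ.aestronglyMeasurable (ae_of_all _ hC)⟩

/-- Split `φ g = φ g(t) + φ (g - g(t))`. Right continuity of `φ` handles the first term. The second
has integral at most `C ∫ |g - g(t)|`, which is `o(u - t)`. -/
theorem IsRightLebesguePoint.hasDerivWithinAt_integral_mul {φ g : ℝ → ℝ} {t C : ℝ}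
    (ht : IsRightLebesguePoint g t) (hg : LocallyIntegrable g volume) (hφ : Measurable φ)
    (hC : ∀ r, |φ r| ≤ C) (hc : ContinuousWithinAt φ (Set.Ioi t) t) :
    HasDerivWithinAt (fun u => ∫ r in t..u, φ r * g r) (φ t * g t) (Set.Ici t) t := by
  have hφl : LocallyIntegrable φ volume := by
    simpa using (locallyIntegrable_const (1 : ℝ)).bounded_mul hφ hC
  have h1 : HasDerivWithinAt (fun u => ∫ r in t..u, φ r) (φ t) (Set.Ici t) t :=
    intervalIntegral.integral_hasDerivWithinAt_right (t := Set.Ioi t)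
      hφl.intervalIntegrable
      hφ.stronglyMeasurable.stronglyMeasurableAtFilter hc
  have hgs : LocallyIntegrable (fun r => g r - g t) volume :=
    hg.sub (locallyIntegrable_const _)
  have h2 : HasDerivWithinAt (fun u => ∫ r in t..u, φ r * (g r - g t)) 0 (Set.Ici t) t := by
    have ht' : HasDerivWithinAt (fun u => ∫ r in t..u, |g r - g t|) 0 (Set.Ici t) t := ht
    rw [hasDerivWithinAt_iff_isLittleO] at ht' ⊢
    refine Asymptotics.IsBigO.trans_isLittleO (.of_bound C ?_) ht'
    filter_upwards [self_mem_nhdsWithin] with u (hu : t ≤ u)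
    simp only [intervalIntegral.integral_same, sub_zero, smul_zero]
    rw [Real.norm_of_nonneg (intervalIntegral.integral_nonneg hu fun r _ => abs_nonneg _),
      ← intervalIntegral.integral_const_mul]
    refine intervalIntegral.norm_integral_le_of_norm_le hu (ae_of_all _ fun r _ => ?_) ?_
    · rw [Real.norm_eq_abs, abs_mul]
      exact mul_le_mul_of_nonneg_right (hC r) (abs_nonneg _)
    · exact hgs.intervalIntegrable.norm.const_mul C
  have h3 := (h1.mul_const (g t)).add h2
  rw [add_zero] at h3
  refine h3.congr_of_mem (fun u _ => ?_) Set.self_mem_Ici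
  simp only [Pi.add_apply]
  rw [← intervalIntegral.integral_mul_const, ← intervalIntegral.integral_add]
  · congr 1; ext r; ring
  · exact (hφl.intervalIntegrable).mul_const _
  · exact (hgs.bounded_mul hφ hC).intervalIntegrable

/-- The entry of a matrix function on `[0, ∞)`, extended by zero to negative times. -/
def entry {E : Type*} (L : ℝ → Matrix E E ℝ) (v w : E) : ℝ → ℝ := (Set.Ici 0).indicator fun t => L t v w

theorem entry_of_nonneg {E : Type*} {L : ℝ → Matrix E E ℝ} {t : ℝ} (ht : 0 ≤ t) (v w : E) : entry L v w t = L t v w :=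
  Set.indicator_of_mem (s := Set.Ici (0 : ℝ)) ht _

theorem IsGeneratorFunction.locallyIntegrable_entry {E : Type*} [Fintype E] [DecidableEq E]
    {L : ℝ → Matrix E E ℝ} (hL : IsGeneratorFunction L) (v w : E) :
    LocallyIntegrable (entry L v w) volume := by
  rw [MeasureTheory.locallyIntegrable_iff]
  intro K hK
  rw [entry, integrableOn_indicator_iff measurableSet_Ici, Set.inter_comm]
  refine (hL.locallyIntegrable v w).integrableOn_compact_subset Set.inter_subset_right ?_
  exact hK.inter_right isClosed_Ici

theorem measurable_history {Ω E : Type*} [MeasurableSpace E] {V : ℝ → Ω → E} {t : ℝ} (ht : 0 ≤ t) : Measurable[history V t] (V t) := by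
  rw [measurable_iff_comap_le]
  exact le_iSup₂_of_le t ⟨ht, le_rfl⟩ le_rfl

theorem measurable_history_of_le {Ω E : Type*} [MeasurableSpace E] {V : ℝ → Ω → E} {s t : ℝ} (hs : 0 ≤ s) (hst : s ≤ t) :
    Measurable[history V t] (V s) := by
  rw [measurable_iff_comap_le]
  exact le_iSup₂_of_le s ⟨hs, hst⟩ le_rfl

theorem measurableSet_state {Ω E : Type*} {m : MeasurableSpace Ω} [MeasurableSpace E]
    [MeasurableSingletonClass E] {W : Ω → E} (hW : Measurable[m] W) (v : E) :
    MeasurableSet[m] {ω | W ω = v} :=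
  hW (measurableSet_singleton v)

/-! ### Joint probabilities with an event, and the Markov property. -/

section Chain

variable {Ω E : Type*} [MeasurableSpace Ω] {μ : Measure Ω} {V : ℝ → Ω → E} {A : Set Ω}

/-- The probability that `A` occurs and that `V` is in the state `v` at time `t`. -/
def jointProb (μ : Measure Ω) (V : ℝ → Ω → E) (A : Set Ω) (t : ℝ) (v : E) : ℝ :=
  μ.real (A ∩ {ω | V t ω = v})

theorem jointProb_nonneg (t : ℝ) (v : E) : 0 ≤ jointProb μ V A t v := measureReal_nonneg

theorem jointProb_eq_zero {t : ℝ} {v : E} (h : μ {ω | V t ω = v} = 0) :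
    jointProb μ V A t v = 0 := by
  rw [jointProb, measureReal_def, measure_mono_null Set.inter_subset_right h,
    ENNReal.toReal_zero]

theorem abs_jointProb_le [IsProbabilityMeasure μ] (t : ℝ) (v : E) :
    |jointProb μ V A t v| ≤ 1 := by
  rw [abs_of_nonneg (jointProb_nonneg t v)]
  exact measureReal_le_one

variable [MeasurableSpace E]

theorem history_le (hV : ∀ t : ℝ, 0 ≤ t → Measurable (V t)) (t : ℝ) :
    history V t ≤ ‹MeasurableSpace Ω› :=
  iSup₂_le fun s hs => (hV s hs.1).comap_le

variable [MeasurableSingletonClass E]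

theorem transProb_eq (hV : ∀ t : ℝ, 0 ≤ t → Measurable (V t)) {s : ℝ} (hs : 0 ≤ s) (t : ℝ)
    (v w : E) :
    transProb μ V s t v w =
      (μ.real {ω | V s ω = v})⁻¹ * jointProb μ V {ω | V s ω = v} t w := by
  rw [transProb, measureReal_def, cond_apply (measurableSet_state (hV s hs) v), ENNReal.toReal_mul,
    ENNReal.toReal_inv]
  rfl

/-- Each path is constant just after each time, so the indicators of the events converge pointwise.
The `max r 0` freezes the process before time `0` and makes the function right continuous on all of
`ℝ`. -/
theorem rightContinuous_jointProb [IsProbabilityMeasure μ]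
    (hV : ∀ t : ℝ, 0 ≤ t → Measurable (V t)) (hc : IsCadlag V) (hA : MeasurableSet A)
    (v : E) (t : ℝ) :
    ContinuousWithinAt (fun r => jointProb μ V A (max r 0) v) (Set.Ioi t) t := by
  have hm (r : ℝ) : MeasurableSet (A ∩ {ω | V (max r 0) ω = v}) :=
    hA.inter (measurableSet_state (hV _ (le_max_right _ _)) v)
  refine (ENNReal.tendsto_toReal (measure_ne_top _ _)).comp
    (tendsto_measure_of_tendsto_indicator_of_isFiniteMeasure _ μ hm fun ω => ?_)
  have key : ∀ᶠ r in 𝓝[>] t, V (max r 0) ω = V (max t 0) ω := by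
    rcases lt_or_ge t 0 with ht | ht
    · filter_upwards [mem_nhdsWithin_of_mem_nhds (Iio_mem_nhds ht)] with r (hr : r < 0)
      rw [max_eq_right hr.le, max_eq_right ht.le]
    · filter_upwards [(hc ω t ht).1, self_mem_nhdsWithin] with r hr (hr' : t < r)
      rw [max_eq_left (ht.trans hr'.le), max_eq_left ht, hr]
  filter_upwards [key] with r hr
  simp [hr]

theorem measurable_jointProb [IsProbabilityMeasure μ]
    (hV : ∀ t : ℝ, 0 ≤ t → Measurable (V t)) (hc : IsCadlag V) (hA : MeasurableSet A) (v : E) :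
    Measurable fun r => jointProb μ V A (max r 0) v :=
  measurable_of_rightContinuous (rightContinuous_jointProb hV hc hA v)

theorem sum_jointProb [IsFiniteMeasure μ] {W : Ω → E} (hW : Measurable W) (s : Finset E) :
    ∑ v ∈ s, μ.real (A ∩ {ω | W ω = v}) = μ.real (A ∩ {ω | W ω ∈ s}) := by
  have h := sum_measureReal_preimage_singleton (μ := μ.restrict A) s (f := W)
    fun y _ => hW (measurableSet_singleton y)
  have hs : MeasurableSet (W ⁻¹' (s : Set E)) := hW s.measurableSet
  rw [measureReal_restrict_apply hs, Set.inter_comm] at h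
  refine Eq.trans (Finset.sum_congr rfl fun v _ => ?_) h
  rw [measureReal_restrict_apply (hW (measurableSet_singleton v)), Set.inter_comm]
  rfl

/-- The conditional probability given the past is a function `φ` of `V s`. Integrating over `A`
gives the sum with weights `φ v`, and integrating over `{V s = v}` identifies `φ v` when that event
is not null. -/
theorem jointProb_eq_sum_transProb [Fintype E] [IsProbabilityMeasure μ]
    (hV : ∀ t : ℝ, 0 ≤ t → Measurable (V t)) (hM : IsMarkovInOwnFiltration μ V)
    {s t : ℝ} (hs : 0 ≤ s) (hst : s ≤ t) (hA : MeasurableSet[history V s] A) (w : E) :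
    jointProb μ V A t w = ∑ v, jointProb μ V A s v * transProb μ V s t v w := by
  have hW : MeasurableSet {ω | V t ω = w} := measurableSet_state (hV t (hs.trans hst)) w
  set B : Set Ω := {ω | V t ω = w} with hB
  have hBi : Integrable (ind B) μ := (integrable_const _).indicator hW
  have hint {D : Set Ω} (hD : MeasurableSet D) : ∫ ω in D, ind B ω ∂μ = μ.real (D ∩ B) := by
    rw [ind, integral_indicator_const _ hW, measureReal_restrict_apply hW, Set.inter_comm]
    simp
  have hle := history_le hV s
  have hle' : MeasurableSpace.comap (V s) inferInstance ≤ ‹MeasurableSpace Ω› := (hV s hs).comap_le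
  have hcond : condExp (history V s) μ (ind B) =ᵐ[μ]
      condExp (MeasurableSpace.comap (V s) inferInstance) μ (ind B) := by
    have := hM s (t - s) hs (sub_nonneg.2 hst) {w} (measurableSet_singleton w)
    rwa [add_sub_cancel] at this
  obtain ⟨φ, -, hφ⟩ := (stronglyMeasurable_condExp (f := ind B) (μ := μ)
    (m := MeasurableSpace.comap (V s) inferInstance)).measurable.exists_eq_measurable_comp
  have hsum {D : Set Ω} (hD : MeasurableSet D) :
      ∫ ω in D, φ (V s ω) ∂μ = ∑ v, μ.real (D ∩ {ω | V s ω = v}) * φ v := by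
    have hm : Measurable (V s) := hV s hs
    rw [← integral_map (φ := V s) (f := φ) hm.aemeasurable
      (measurable_of_finite φ).aestronglyMeasurable, integral_fintype .of_finite]
    refine Finset.sum_congr rfl fun v _ => ?_
    rw [map_measureReal_apply hm (measurableSet_singleton v),
      measureReal_restrict_apply (hm (measurableSet_singleton v)), Set.inter_comm, smul_eq_mul]
    rfl
  have h1 : jointProb μ V A t w = ∑ v, jointProb μ V A s v * φ v := by
    unfold jointProb
    rw [← hsum (hle _ hA), ← hint (hle _ hA), ← setIntegral_condExp hle hBi hA]
    refine integral_congr_ae (ae_restrict_of_ae ?_)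
    filter_upwards [hcond] with ω hω
    rw [hω, hφ]
    rfl
  rw [h1]
  refine Finset.sum_congr rfl fun v _ => ?_
  by_cases h0 : μ {ω | V s ω = v} = 0
  · rw [jointProb_eq_zero h0, zero_mul, zero_mul]
  congr 1
  have hD : MeasurableSet[MeasurableSpace.comap (V s) inferInstance] {ω | V s ω = v} :=
    ⟨{v}, measurableSet_singleton v, rfl⟩
  have h2 := setIntegral_condExp hle' hBi hD
  rw [hint (hle' _ hD), hφ] at h2
  have h3 : ∫ ω in {ω | V s ω = v}, φ (V s ω) ∂μ = μ.real {ω | V s ω = v} * φ v := by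
    rw [setIntegral_congr_fun (g := fun _ => φ v) (hle' _ hD)
      fun ω hω => congrArg φ hω, setIntegral_const, smul_eq_mul]
  have h4 : μ.real {ω | V s ω = v} ≠ 0 := (measureReal_ne_zero_iff).2 h0
  have h5 : μ.real {ω | V s ω = v} * φ v = μ.real ({ω | V s ω = v} ∩ B) := h3.symm.trans h2
  rw [transProb_eq hV hs, jointProb, ← hB, ← h5, inv_mul_cancel_left₀ h4]

end Chain

/-! ### The forward equation on events of the past. -/

theorem IsGeneratorFunction.ae_isRightLebesguePoint {E : Type*} [Fintype E] [DecidableEq E]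
    {L : ℝ → Matrix E E ℝ} (hL : IsGeneratorFunction L) :
    ∀ᵐ t, ∀ v w, IsRightLebesguePoint (entry L v w) t :=
  ae_all_iff.2 fun v => ae_all_iff.2 fun w =>
    MarkovConsistency.ae_isRightLebesguePoint (hL.locallyIntegrable_entry v w)

section Forward

variable {Ω E : Type*} [MeasurableSpace Ω] {μ : Measure Ω} [IsProbabilityMeasure μ]
  [Fintype E] [DecidableEq E] [MeasurableSpace E] [MeasurableSingletonClass E]
  {V : ℝ → Ω → E} {L : ℝ → Matrix E E ℝ} {A : Set Ω}

theorem IsMarkovChainWithGenerator.locallyIntegrable_jointProb_mul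
    (hV : IsMarkovChainWithGenerator μ V L) (hA : MeasurableSet A) (u w : E) :
    LocallyIntegrable (fun r => jointProb μ V A (max r 0) u * entry L u w r) volume :=
  (hV.generator.locallyIntegrable_entry u w).bounded_mul
    (measurable_jointProb hV.measurable hV.cadlag hA u) fun r => abs_jointProb_le (max r 0) u

theorem IsMarkovChainWithGenerator.intervalIntegrable_jointProb_mul
    (hV : IsMarkovChainWithGenerator μ V L) (hA : MeasurableSet A) {s t : ℝ} (hs : 0 ≤ s)
    (hst : s ≤ t) (u w : E) :
    IntervalIntegrable (fun r => jointProb μ V A r u * L r u w) volume s t := by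
  refine (hV.locallyIntegrable_jointProb_mul hA u w).intervalIntegrable.congr fun r hr => ?_
  rw [Set.uIoc_of_le hst] at hr
  have hr0 : 0 ≤ r := hs.trans hr.1.le
  simp only [max_eq_left hr0, entry_of_nonneg hr0]

/-- The Kolmogorov forward equation, conditionally on an event of the past. -/
theorem IsMarkovChainWithGenerator.jointProb_eq_add_integral
    (hV : IsMarkovChainWithGenerator μ V L) {s t : ℝ} (hs : 0 ≤ s) (hst : s ≤ t)
    (hA : MeasurableSet[history V s] A) (w : E) :
    jointProb μ V A t w =
      jointProb μ V A s w + ∫ r in s..t, ∑ u, jointProb μ V A r u * L r u w := by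
  have h1 (v : E) : jointProb μ V A s v * transProb μ V s t v w =
      jointProb μ V A s v * (1 : Matrix E E ℝ) v w +
        ∫ r in s..t, jointProb μ V A s v * ∑ u, transProb μ V s r v u * L r u w := by
    -- The Kolmogorov equation is not available at null states, but there the weight vanishes.
    by_cases h0 : μ {ω | V s ω = v} = 0
    · simp [jointProb_eq_zero h0]
    · rw [hV.kolmogorov s t hs hst v w h0, mul_add, intervalIntegral.integral_const_mul]
  rw [jointProb_eq_sum_transProb hV.measurable hV.markov hs hst hA,
    Finset.sum_congr rfl fun v _ => h1 v, Finset.sum_add_distrib]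
  congr 1
  · simp [Matrix.one_apply]
  · rw [← intervalIntegral.integral_finsetSum]
    · refine intervalIntegral.integral_congr fun r hr => ?_
      rw [Set.uIcc_of_le hst] at hr
      simp only [Finset.mul_sum]
      rw [Finset.sum_comm]
      refine Finset.sum_congr rfl fun u _ => ?_
      -- Inside the integral the sum over the state at time `s` recombines into the joint
      -- probability at time `r`.
      rw [jointProb_eq_sum_transProb hV.measurable hV.markov hs hr.1 hA, Finset.sum_mul]
      exact Finset.sum_congr rfl fun v _ => (mul_assoc _ _ _).symm
    · intro v _
      refine IntervalIntegrable.const_mul ?_ _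
      have hu (u : E) : IntervalIntegrable (fun r => transProb μ V s r v u * L r u w)
          volume s t := by
        simp only [transProb_eq hV.measurable hs, mul_assoc]
        exact (hV.intervalIntegrable_jointProb_mul (measurableSet_state (hV.measurable s hs) v)
          hs hst u w).const_mul _
      simpa only [Finset.sum_fn] using IntervalIntegrable.sum Finset.univ fun u _ => hu u

/-- The forward differential equation at the Lebesgue points of the generator, conditionally on
an event of the past. -/
theorem IsMarkovChainWithGenerator.hasDerivWithinAt_jointProb
    (hV : IsMarkovChainWithGenerator μ V L) {t : ℝ} (ht : 0 ≤ t)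
    (hLt : ∀ v w, IsRightLebesguePoint (entry L v w) t)
    (hA : MeasurableSet[history V t] A) (w : E) :
    HasDerivWithinAt (fun r => jointProb μ V A r w) (∑ u, jointProb μ V A t u * L t u w)
      (Set.Ici t) t := by
  have hA' : MeasurableSet A := history_le hV.measurable t _ hA
  have h1 (u : E) := (hLt u w).hasDerivWithinAt_integral_mul
    (hV.generator.locallyIntegrable_entry u w)
    (measurable_jointProb hV.measurable hV.cadlag hA' u)
    (fun r => abs_jointProb_le (μ := μ) (V := V) (A := A) (max r 0) u)
    (rightContinuous_jointProb hV.measurable hV.cadlag hA' u t)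
  have h2 := (HasDerivWithinAt.fun_sum fun u (_ : u ∈ Finset.univ) => h1 u).const_add
    (jointProb μ V A t w)
  simp only [max_eq_left ht, entry_of_nonneg ht] at h2
  refine h2.congr_of_mem (fun r (hr : t ≤ r) => ?_) Set.self_mem_Ici
  rw [hV.jointProb_eq_add_integral ht hr hA,
    ← intervalIntegral.integral_finsetSum fun u _ =>
      (hV.locallyIntegrable_jointProb_mul hA' u w).intervalIntegrable]
  congr 1
  refine intervalIntegral.integral_congr fun r' hr' => ?_
  rw [Set.uIcc_of_le hr] at hr'
  have h0 : 0 ≤ r' := ht.trans hr'.1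
  simp only [max_eq_left h0, entry_of_nonneg h0]

end Forward

/-- Turns almost sure identities carrying an indicator into identities at states of positive
probability. -/
theorem ae_ind_mul_eq_iff {Ω : Type*} [MeasurableSpace Ω] {μ : Measure Ω} (B : Set Ω) (c d : ℝ) :
    (∀ᵐ ω ∂μ, ind B ω * c = ind B ω * d) ↔ (μ B ≠ 0 → c = d) := by
  constructor
  · intro h hB
    by_contra hcd
    refine hB (measure_mono_null (fun ω hω => ?_) h)
    simp only [Set.mem_compl_iff, Set.mem_ofPred_eq]
    simpa [ind, Set.indicator_of_mem hω] using hcd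
  · intro h
    by_cases hB : μ B = 0
    · filter_upwards [measure_eq_zero_iff_ae_notMem.1 hB] with ω hω
      simp [ind, hω]
    · simp [h hB]

/-! ### The projected generator, the operator identity and the two intensity conditions. -/

section Projection

set_option linter.unusedSectionVars false

variable {Ω : Type*} [MeasurableSpace Ω] {μ : Measure Ω} [IsProbabilityMeasure μ]
  {S : Fin 2 → Type*} [∀ k, Fintype (S k)] [∀ k, DecidableEq (S k)]
  [∀ k, MeasurableSpace (S k)] [∀ k, MeasurableSingletonClass (S k)]
  {X : ℝ → Ω → (∀ k, S k)} {L : ℝ → Matrix (∀ k, S k) (∀ k, S k) ℝ} {i : Fin 2} {t : ℝ}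
  {A : Set Ω}

/-- The intensity at which the `i`-th component jumps to `y` when the whole process is in `u`. -/
def componentRate {S : Fin 2 → Type*} [∀ k, Fintype (S k)] [∀ k, DecidableEq (S k)]
    (L : ℝ → Matrix (∀ k, S k) (∀ k, S k) ℝ) (i : Fin 2) (t : ℝ) (u : ∀ k, S k) (y : S i) : ℝ :=
  ∑ w with w i = y, L t u w

/-- The mean intensity of jumps of the `i`-th component from `x` to `y` given that it is in `x`,
that is, the matrix of `Q^i_t Λ(t) C^{i,*}`. -/
def projectedGenerator (μ : Measure Ω) (X : ℝ → Ω → (∀ k, S k))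
    (L : ℝ → Matrix (∀ k, S k) (∀ k, S k) ℝ) (i : Fin 2) (t : ℝ) : Matrix (S i) (S i) ℝ :=
  fun x y => (μ.real {ω | component X i t ω = x})⁻¹ *
    ∑ u, jointProb μ X {ω | component X i t ω = x} t u * componentRate L i t u y

theorem measurable_component {m : MeasurableSpace Ω} (h : Measurable[m] (X t)) (i : Fin 2) :
    Measurable[m] (component X i t) :=
  (measurable_pi_apply i).comp h

theorem history_component_le (X : ℝ → Ω → (∀ k, S k)) (i : Fin 2) (t : ℝ) :
    history (component X i) t ≤ history X t :=
  iSup₂_le fun _ hs =>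
    (measurable_iff_comap_le).1 (measurable_component (measurable_history_of_le hs.1 hs.2) i)

theorem jointProb_component (h : Measurable (X t)) (A : Set Ω) (y : S i) :
    jointProb μ (component X i) A t y = ∑ w with w i = y, jointProb μ X A t w := by
  unfold jointProb
  rw [sum_jointProb h]
  congr 2
  ext ω
  simp [component]

theorem jointProb_eq_zero_of_ne {x : S i} {u : ∀ k, S k} (hu : u i ≠ x) :
    jointProb μ X (A ∩ {ω | component X i t ω = x}) t u = 0 := by
  have : A ∩ {ω | component X i t ω = x} ∩ {ω | X t ω = u} = ∅ := by
    ext ω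
    simp only [component, Set.mem_inter_iff, Set.mem_ofPred_eq, Set.mem_empty_iff_false, iff_false]
    rintro ⟨⟨-, rfl⟩, rfl⟩
    exact hu rfl
  rw [jointProb, this, measureReal_empty]

theorem inter_component_eq (A : Set Ω) (z : ∀ k, S k) :
    A ∩ {ω | component X i t ω = z i} ∩ {ω | component X (1 - i) t ω = z (1 - i)} =
      A ∩ {ω | component X i t ω = z i} ∩ {ω | X t ω = z} := by
  ext ω
  simp only [component, Set.mem_inter_iff, Set.mem_ofPred_eq, and_assoc, and_congr_right_iff]
  refine fun _ h => ⟨fun h' => ?_, fun h' => by rw [h']⟩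
  funext k
  have hk : k = i ∨ k = 1 - i := by omega
  rcases hk with rfl | rfl
  exacts [h, h']

/-- On `{X^i_t = x}` the other component determines the whole state; states outside this fibre
contribute zero. -/
theorem sum_mul_measureReal_eq (A : Set Ω) (x y : S i) :
    ∑ z with z i = x, ∑ w with w i = y, L t z w *
        μ.real (A ∩ {ω | component X i t ω = x} ∩
          {ω | component X (1 - i) t ω = z (1 - i)}) =
      ∑ u, jointProb μ X (A ∩ {ω | component X i t ω = x}) t u * componentRate L i t u y := by
  rw [Finset.sum_filter]
  refine Finset.sum_congr rfl fun z _ => ?_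
  split_ifs with hz
  · subst hz
    rw [inter_component_eq, ← Finset.sum_mul, mul_comm]
    rfl
  · rw [jointProb_eq_zero_of_ne hz, zero_mul]

theorem sum_componentRate (hL : IsGeneratorFunction L) (ht : 0 ≤ t) (u : ∀ k, S k) :
    ∑ y, componentRate L i t u y = 0 := by
  unfold componentRate
  rw [Finset.sum_fiberwise, ← Finset.add_sum_erase _ _ (Finset.mem_univ u), hL.diagonal t ht u,
    ← Finset.filter_ne', neg_add_cancel]

theorem sum_projectedGenerator (hL : IsGeneratorFunction L) (ht : 0 ≤ t) (x : S i) :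
    ∑ y, projectedGenerator μ X L i t x y = 0 := by
  unfold projectedGenerator
  rw [← Finset.mul_sum, Finset.sum_comm]
  simp [← Finset.mul_sum, sum_componentRate hL ht]

/-- Zero row sums are inherited from `L`. This includes null states `x`, whose row is zero because
`0⁻¹ = 0`. -/
theorem projectedGenerator_diagonal (hL : IsGeneratorFunction L) (ht : 0 ≤ t) (x : S i) :
    projectedGenerator μ X L i t x x = -∑ y with y ≠ x, projectedGenerator μ X L i t x y := by
  have h := sum_projectedGenerator (μ := μ) (X := X) hL ht x
  rw [← Finset.add_sum_erase _ _ (Finset.mem_univ x), ← Finset.filter_ne'] at h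
  exact eq_neg_of_add_eq_zero_left h

theorem Q_eq (h : Measurable (X t)) (f : (∀ k, S k) → ℝ) (x : S i) :
    Q μ X i t f x = (μ.real {ω | component X i t ω = x})⁻¹ *
      ∑ u, jointProb μ X {ω | component X i t ω = x} t u * f u := by
  have hB : MeasurableSet {ω | component X i t ω = x} :=
    measurableSet_state (measurable_component h i) x
  rw [Q, ProbabilityTheory.cond, integral_smul_measure, ENNReal.toReal_inv, smul_eq_mul,
    ← integral_map (φ := X t) (f := f) h.aemeasurable
      (measurable_of_finite f).aestronglyMeasurable, integral_fintype .of_finite]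
  congr 1
  refine Finset.sum_congr rfl fun v _ => ?_
  rw [map_measureReal_apply h (measurableSet_singleton v),
      measureReal_restrict_apply (h (measurableSet_singleton v)), Set.inter_comm, smul_eq_mul]
  rfl

theorem Q_mulVec_extension (h : Measurable (X t)) (g : S i → ℝ) (x : S i) :
    Q μ X i t (L t *ᵥ extension i g) x = (projectedGenerator μ X L i t *ᵥ g) x := by
  have h1 (u : ∀ k, S k) :
      (L t *ᵥ extension i g) u = ∑ y, componentRate L i t u y * g y := by
    simp only [Matrix.mulVec, dotProduct, extension, componentRate]
    rw [← Finset.sum_fiberwise _ fun w : ∀ k, S k => w i]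
    refine Finset.sum_congr rfl fun y _ => ?_
    rw [Finset.sum_mul]
    refine Finset.sum_congr rfl fun w hw => ?_
    rw [(Finset.mem_filter.1 hw).2]
  rw [Q_eq h, funext h1]
  simp only [Matrix.mulVec, dotProduct, projectedGenerator, Finset.mul_sum, Finset.sum_mul]
  rw [Finset.sum_comm]
  simp only [mul_assoc]

theorem operatorIdentity_iff (h : Measurable (X t)) (Li : ℝ → Matrix (S i) (S i) ℝ) :
    OperatorIdentity μ X L i Li t ↔
      ∀ x y, μ {ω | component X i t ω = x} ≠ 0 → projectedGenerator μ X L i t x y = Li t x y := by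
  simp only [OperatorIdentity, Q_mulVec_extension h]
  constructor
  · intro H x y hx
    -- Testing on the indicator of `y` extracts the matrix entry.
    simpa using H (Pi.single y 1) x hx
  · intro H g x hx
    simp only [Matrix.mulVec, dotProduct]
    exact Finset.sum_congr rfl fun y _ => by rw [H x y hx]

/-- Both diagonals are determined by the off-diagonal entries of their row. -/
theorem operatorIdentity_iff_of_ne (h : Measurable (X t)) (hL : IsGeneratorFunction L)
    (ht : 0 ≤ t) {Li : ℝ → Matrix (S i) (S i) ℝ} (hLi : HasGeneratorDiagonal Li) :
    OperatorIdentity μ X L i Li t ↔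
      ∀ x y, x ≠ y → μ {ω | component X i t ω = x} ≠ 0 →
        projectedGenerator μ X L i t x y = Li t x y := by
  rw [operatorIdentity_iff h]
  refine ⟨fun H x y _ => H x y, fun H x y hx => ?_⟩
  rcases eq_or_ne x y with rfl | hxy
  · rw [projectedGenerator_diagonal hL ht, hLi t ht]
    exact congrArg Neg.neg (Finset.sum_congr rfl fun y hy =>
      H x y (Finset.mem_filter.1 hy).2.symm hx)
  · exact H x y hxy hx

theorem sum_mul_cond_eq (h : Measurable (X t)) (x y : S i) :
    ∑ z with z i = x, ∑ w with w i = y, L t z w *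
        (μ[|{ω | component X i t ω = x}]).real {ω | component X (1 - i) t ω = z (1 - i)} =
      projectedGenerator μ X L i t x y := by
  have h1 := sum_mul_measureReal_eq (μ := μ) (X := X) (L := L) (t := t) Set.univ x y
  simp only [Set.univ_inter] at h1
  rw [projectedGenerator, ← h1]
  simp only [Finset.mul_sum]
  refine Finset.sum_congr rfl fun z _ => Finset.sum_congr rfl fun w _ => ?_
  rw [measureReal_def, cond_apply (measurableSet_state (measurable_component h i) x),
    ENNReal.toReal_mul, ENNReal.toReal_inv, measureReal_def, measureReal_def]
  ring

theorem stateIntensity_iff (hX : ∀ t : ℝ, 0 ≤ t → Measurable (X t)) (hL : IsGeneratorFunction L)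
    {Li : ℝ → Matrix (S i) (S i) ℝ} (hLi : HasGeneratorDiagonal Li) :
    StateIntensity μ X L i Li ↔
      ∀ᵐ t ∂(volume.restrict (Set.Ici (0 : ℝ))), OperatorIdentity μ X L i Li t := by
  simp only [StateIntensity, ae_ind_mul_eq_iff]
  have h1 : (∀ᵐ t ∂(volume.restrict (Set.Ici (0 : ℝ))), OperatorIdentity μ X L i Li t) ↔
      ∀ᵐ t ∂(volume.restrict (Set.Ici (0 : ℝ))), ∀ x y, x ≠ y →
        μ {ω | component X i t ω = x} ≠ 0 → projectedGenerator μ X L i t x y = Li t x y := by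
    refine eventually_congr ?_
    filter_upwards [ae_restrict_mem measurableSet_Ici] with t ht
    exact operatorIdentity_iff_of_ne (hX t ht) hL ht hLi
  rw [h1]
  simp only [ae_all_iff]
  refine forall₃_congr fun x y _ => eventually_congr ?_
  filter_upwards [ae_restrict_mem measurableSet_Ici] with t ht
  rw [sum_mul_cond_eq (hX t ht)]

/-- The integral of the left-hand side of the history intensity condition over an event of the
history. -/
theorem setIntegral_ind_mul_sum_condExp (hX : ∀ t : ℝ, 0 ≤ t → Measurable (X t)) (ht : 0 ≤ t)
    (hA : MeasurableSet[history (component X i) t] A) (x y : S i) :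
    ∫ ω in A, ind {ω | component X i t ω = x} ω *
        ∑ z with z i = x, ∑ w with w i = y, L t z w *
          condExp (history (component X i) t) μ
            (ind {ω | component X (1 - i) t ω = z (1 - i)}) ω ∂μ =
      ∑ u, jointProb μ X (A ∩ {ω | component X i t ω = x}) t u * componentRate L i t u y := by
  have hle := history_le (V := component X i) fun t ht => measurable_component (hX t ht) i
  have hB : MeasurableSet[history (component X i) t] {ω | component X i t ω = x} :=
    measurableSet_state (measurable_history ht) x
  have hC (z : ∀ k, S k) : MeasurableSet {ω | component X (1 - i) t ω = z (1 - i)} :=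
    measurableSet_state (measurable_component (hX t ht) (1 - i)) _
  have hi (z : ∀ k, S k) : Integrable (ind {ω | component X (1 - i) t ω = z (1 - i)}) μ :=
    (integrable_const _).indicator (hC z)
  have h1 : (fun ω => ind {ω | component X i t ω = x} ω *
      ∑ z with z i = x, ∑ w with w i = y, L t z w *
          condExp (history (component X i) t) μ
            (ind {ω | component X (1 - i) t ω = z (1 - i)}) ω) =
      {ω | component X i t ω = x}.indicator (fun ω =>
      ∑ z with z i = x, ∑ w with w i = y, L t z w *
          condExp (history (component X i) t) μ
            (ind {ω | component X (1 - i) t ω = z (1 - i)}) ω) := by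
    funext ω
    by_cases hω : ω ∈ {ω | component X i t ω = x}
    · rw [ind, Set.indicator_of_mem hω, Set.indicator_of_mem hω, one_mul]
    · rw [ind, Set.indicator_of_notMem hω, Set.indicator_of_notMem hω, zero_mul]
  -- The indicator shrinks the domain to `A ∩ {X^i_t = x}`, still an event of the history, so each
  -- conditional expectation integrates to a probability.
  rw [h1, setIntegral_indicator (hle t _ hB), ← sum_mul_measureReal_eq, integral_finsetSum]
  · refine Finset.sum_congr rfl fun z _ => ?_
    rw [integral_finsetSum]
    · refine Finset.sum_congr rfl fun w _ => ?_
      rw [integral_const_mul, setIntegral_condExp (hle t) (hi z) (hA.inter hB), ind,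
        integral_indicator_const _ (hC z), measureReal_restrict_apply (hC z), Set.inter_comm]
      simp
    · exact fun w _ => (integrable_condExp.const_mul _).integrableOn
  · exact fun z _ => integrable_finsetSum _ fun w _ =>
      (integrable_condExp.const_mul _).integrableOn

theorem integrable_ind_mul_sum_condExp (x y : S i)
    (hX : ∀ t : ℝ, 0 ≤ t → Measurable (X t)) (ht : 0 ≤ t) :
    Integrable (fun ω => ind {ω | component X i t ω = x} ω *
        ∑ z with z i = x, ∑ w with w i = y, L t z w *
          condExp (history (component X i) t) μ
            (ind {ω | component X (1 - i) t ω = z (1 - i)}) ω) μ := by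
  have hB : MeasurableSet {ω | component X i t ω = x} :=
    measurableSet_state (measurable_component (hX t ht) i) x
  refine Integrable.bdd_mul (c := 1) (integrable_finsetSum _ fun z _ =>
    integrable_finsetSum _ fun w _ => integrable_condExp.const_mul _)
    (measurable_const.indicator hB).aestronglyMeasurable (ae_of_all _ fun ω => ?_)
  by_cases hω : ω ∈ {ω | component X i t ω = x} <;> simp [ind, hω]

/-- Integrate the history condition over `Ω` and divide by `P(X^i_t = x)`; weak consistency plays no
role. -/
theorem HistoryIntensity.stateIntensity (hX : ∀ t : ℝ, 0 ≤ t → Measurable (X t))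
    {Li : ℝ → Matrix (S i) (S i) ℝ} (h : HistoryIntensity μ X L i Li) :
    StateIntensity μ X L i Li := by
  intro x y hxy
  filter_upwards [h x y hxy, ae_restrict_mem measurableSet_Ici] with t hω ht
  rw [ae_ind_mul_eq_iff, sum_mul_cond_eq (hX t ht)]
  intro hx
  have hB : MeasurableSet {ω | component X i t ω = x} :=
    measurableSet_state (measurable_component (hX t ht) i) x
  have h1 := setIntegral_ind_mul_sum_condExp (μ := μ) (L := L) hX ht (A := Set.univ)
    MeasurableSet.univ x y
  rw [setIntegral_univ, integral_congr_ae hω, integral_mul_const, Set.univ_inter, ind,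
    integral_indicator_const _ hB, smul_eq_mul, mul_one] at h1
  rw [projectedGenerator, ← h1, inv_mul_cancel_left₀ ((measureReal_ne_zero_iff).2 hx)]

end Projection

/-! ### Consequences of weak consistency. -/

/-- Once the present state is fixed at `x`, the past event enters only through its probability. -/
theorem IsMarkovInOwnFiltration.jointProb_inter_state {Ω E : Type*} [MeasurableSpace Ω]
    {μ : Measure Ω} [IsProbabilityMeasure μ] [Fintype E] [MeasurableSpace E]
    [MeasurableSingletonClass E] {V : ℝ → Ω → E} {A : Set Ω}
    (hM : IsMarkovInOwnFiltration μ V) (hV : ∀ t : ℝ, 0 ≤ t → Measurable (V t))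
    {s t : ℝ} (hs : 0 ≤ s) (hst : s ≤ t) (hA : MeasurableSet[history V s] A) (x y : E) :
    jointProb μ V (A ∩ {ω | V s ω = x}) t y =
      μ.real (A ∩ {ω | V s ω = x}) * transProb μ V s t x y := by
  rw [jointProb_eq_sum_transProb hV hM hs hst
    (hA.inter (measurableSet_state (measurable_history hs) x)),
    Finset.sum_eq_single x]
  · rw [jointProb, Set.inter_assoc, Set.inter_self]
  · intro v _ hv
    have : A ∩ {ω | V s ω = x} ∩ {ω | V s ω = v} = ∅ := by
      ext ω
      simp only [Set.mem_inter_iff, Set.mem_ofPred_eq, Set.mem_empty_iff_false, iff_false]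
      rintro ⟨⟨-, rfl⟩, rfl⟩
      exact hv rfl
    rw [jointProb, this, measureReal_empty, zero_mul]
  · simp

section Consistency

set_option linter.unusedSectionVars false

variable {Ω : Type*} [MeasurableSpace Ω] {μ : Measure Ω} [IsProbabilityMeasure μ]
  {S : Fin 2 → Type*} [∀ k, Fintype (S k)] [∀ k, DecidableEq (S k)]
  [∀ k, MeasurableSpace (S k)] [∀ k, MeasurableSingletonClass (S k)]
  {X : ℝ → Ω → (∀ k, S k)} {L : ℝ → Matrix (∀ k, S k) (∀ k, S k) ℝ} {i : Fin 2} {t : ℝ}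
  {A : Set Ω}

theorem IsMarkovChainWithGenerator.hasDerivWithinAt_jointProb_component
    (hX : IsMarkovChainWithGenerator μ X L) (ht : 0 ≤ t)
    (hLt : ∀ v w, IsRightLebesguePoint (entry L v w) t)
    (hA : MeasurableSet[history X t] A) (y : S i) :
    HasDerivWithinAt (fun r => jointProb μ (component X i) A r y)
      (∑ u, jointProb μ X A t u * componentRate L i t u y) (Set.Ici t) t := by
  have h := HasDerivWithinAt.fun_sum fun w (_ : w ∈ Finset.univ.filter fun w => w i = y) =>
    hX.hasDerivWithinAt_jointProb ht hLt hA w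
  rw [Finset.sum_comm] at h
  simp only [← Finset.mul_sum] at h
  exact h.congr_of_mem (fun r (hr : t ≤ r) =>
    jointProb_component (hX.measurable r (ht.trans hr)) A y) Set.self_mem_Ici

/-- Under weak consistency the mean intensity of jumps of the `i`-th component, given its history,
depends on the present state only. -/
theorem WeaklyConsistent.sum_jointProb_mul_componentRate
    (hX : IsMarkovChainWithGenerator μ X L) (hW : WeaklyConsistent μ X i) (ht : 0 ≤ t)
    (hLt : ∀ v w, IsRightLebesguePoint (entry L v w) t)
    (hA : MeasurableSet[history (component X i) t] A) (x y : S i) :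
    ∑ u, jointProb μ X (A ∩ {ω | component X i t ω = x}) t u * componentRate L i t u y =
      μ.real (A ∩ {ω | component X i t ω = x}) * projectedGenerator μ X L i t x y := by
  by_cases hx : μ {ω | component X i t ω = x} = 0
  · have h0 : μ (A ∩ {ω | component X i t ω = x}) = 0 :=
      measure_mono_null Set.inter_subset_right hx
    have h1 (u) : jointProb μ X (A ∩ {ω | component X i t ω = x}) t u = 0 := by
      rw [jointProb, measureReal_def, measure_mono_null Set.inter_subset_left h0,
        ENNReal.toReal_zero]
    simp [h1, measureReal_def, h0]
  have hV (t : ℝ) (ht : 0 ≤ t) : Measurable (component X i t) :=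
    measurable_component (hX.measurable t ht) i
  have hB : MeasurableSet[history (component X i) t] {ω | component X i t ω = x} :=
    measurableSet_state (measurable_history ht) x
  have hle := history_component_le X i t
  have hd1 := hX.hasDerivWithinAt_jointProb_component ht hLt (hle _ (hA.inter hB)) y
  -- The factor is `P(A | X^i_t = x)`. By the Markov property of `X^i` it relates the two joint
  -- probabilities for all `r ≥ t`, so uniqueness of the right derivative gives the claim.
  have hd2 := (hX.hasDerivWithinAt_jointProb_component ht hLt (hle _ hB) y).const_mul
    (μ.real (A ∩ {ω | component X i t ω = x}) * (μ.real {ω | component X i t ω = x})⁻¹)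
  have h2 := (uniqueDiffWithinAt_Ici t).eq_deriv _ hd1 (hd2.congr_of_mem
    (fun r (hr : t ≤ r) => ?_) Set.self_mem_Ici)
  · rw [h2, projectedGenerator, mul_assoc]
  · rw [IsMarkovInOwnFiltration.jointProb_inter_state hW hV ht hr hA, transProb_eq hV ht, mul_assoc]

/-- Both sides are integrable and measurable for the history at `t`, so it suffices to compare their
integrals over its events. -/
theorem WeaklyConsistent.historyIntensity (hX : IsMarkovChainWithGenerator μ X L)
    (hW : WeaklyConsistent μ X i) :
    HistoryIntensity μ X L i (projectedGenerator μ X L i) := by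
  intro x y _
  filter_upwards [ae_restrict_of_ae hX.generator.ae_isRightLebesguePoint,
    ae_restrict_mem measurableSet_Ici] with t hLt ht
  have hV (t : ℝ) (ht : 0 ≤ t) : Measurable (component X i t) :=
    measurable_component (hX.measurable t ht) i
  have hle := history_le hV t
  have hB : MeasurableSet[history (component X i) t] {ω | component X i t ω = x} :=
    measurableSet_state (measurable_history ht) x
  have hBi : StronglyMeasurable[history (component X i) t]
      (ind {ω | component X i t ω = x}) := stronglyMeasurable_const.indicator hB
  have hi := integrable_ind_mul_sum_condExp (μ := μ) (L := L) x y hX.measurable ht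
  have hi' : Integrable (fun ω => ind {ω | component X i t ω = x} ω *
      projectedGenerator μ X L i t x y) μ :=
    ((integrable_const _).indicator (hle _ hB)).mul_const _
  refine ae_eq_of_forall_setIntegral_eq_of_sigmaFinite' hle (fun _ _ _ => hi.integrableOn)
    (fun _ _ _ => hi'.integrableOn) (fun A hA _ => ?_) ?_ ?_
  · rw [setIntegral_ind_mul_sum_condExp hX.measurable ht hA,
      hW.sum_jointProb_mul_componentRate hX ht hLt hA, integral_mul_const, ind,
      setIntegral_indicator (hle _ hB), setIntegral_const, smul_eq_mul, mul_one]
  · refine (hBi.mul ?_).aestronglyMeasurable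
    exact Finset.stronglyMeasurable_fun_sum _ fun z _ =>
      Finset.stronglyMeasurable_fun_sum _ fun w _ => stronglyMeasurable_condExp.const_mul _
  · exact (hBi.mul stronglyMeasurable_const).aestronglyMeasurable

theorem IsCadlag.component (hX : IsCadlag X) (i : Fin 2) : IsCadlag (component X i) := by
  refine fun ω t ht => ⟨(hX ω t ht).1.mono fun s hs => congrFun hs i, fun h0 => ?_⟩
  obtain ⟨v, hv⟩ := (hX ω t ht).2 h0
  exact ⟨v i, hv.mono fun s hs => congrFun hs i⟩

theorem isGeneratorFunction_projectedGenerator (hX : IsMarkovChainWithGenerator μ X L)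
    (i : Fin 2) : IsGeneratorFunction (projectedGenerator μ X L i) where
  locallyIntegrable x y := by
    rw [locallyIntegrableOn_iff isClosed_Ici.isLocallyClosed]
    intro K hK0 hK
    -- The entries average the component rates with conditional probabilities as weights: measurable
    -- in time and bounded by `1`.
    have hm (v) : Measurable fun r => (μ.real {ω | component X i (max r 0) ω = x})⁻¹ *
        jointProb μ X {ω | component X i (max r 0) ω = x} (max r 0) v := by
      have h1 : Measurable fun r => jointProb μ (component X i) Set.univ (max r 0) x :=
        measurable_jointProb (fun t ht => measurable_component (hX.measurable t ht) i)
          (hX.cadlag.component i) MeasurableSet.univ x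
      simp only [jointProb, Set.univ_inter] at h1
      refine h1.inv.mul ?_
      -- If `v i = x`, the time-dependent event `{X^i_r = x}` is implied by `X_r = v` and can be
      -- replaced by the fixed event `univ`.
      by_cases hv : v i = x
      · have h2 := measurable_jointProb hX.measurable hX.cadlag MeasurableSet.univ v (μ := μ)
        convert h2 using 2 with r
        unfold jointProb
        congr 1
        ext ω
        simp only [component, Set.mem_inter_iff, Set.mem_ofPred_eq, Set.mem_univ, true_and,
          and_iff_right_iff_imp]
        rintro h
        rw [h, hv]
      · have h2 (r) : jointProb μ X {ω | component X i (max r 0) ω = x} (max r 0) v = 0 := by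
          have := jointProb_eq_zero_of_ne (μ := μ) (X := X) (A := Set.univ) (t := max r 0) hv
          rwa [Set.univ_inter] at this
        simp only [h2]
        exact measurable_const
    have hb (v) (r : ℝ) : ‖(μ.real {ω | component X i (max r 0) ω = x})⁻¹ *
        jointProb μ X {ω | component X i (max r 0) ω = x} (max r 0) v‖ ≤ 1 := by
      rw [Real.norm_of_nonneg (mul_nonneg (inv_nonneg.2 measureReal_nonneg)
        (jointProb_nonneg _ _))]
      exact inv_mul_le_one_of_le₀ (measureReal_mono Set.inter_subset_left) measureReal_nonneg
    have hint (v) : IntegrableOn (fun r => componentRate L i r v y) K volume :=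
      integrable_finsetSum _ fun w _ =>
        (hX.generator.locallyIntegrable v w).integrableOn_compact_subset hK0 hK
    have hsum := integrable_finsetSum Finset.univ fun v _ =>
      Integrable.bdd_mul (hint v) (hm v).aestronglyMeasurable (ae_of_all _ (hb v))
    refine IntegrableOn.congr_fun hsum (fun r hr => ?_) hK.measurableSet
    simp only [max_eq_left (show (0 : ℝ) ≤ r from hK0 hr), projectedGenerator, Finset.mul_sum,
      mul_assoc]
  nonneg t ht x y hxy := by
    refine mul_nonneg (inv_nonneg.2 measureReal_nonneg) (Finset.sum_nonneg fun u _ => ?_)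
    by_cases hu : u i = x
    · refine mul_nonneg (jointProb_nonneg _ _) (Finset.sum_nonneg fun w hw => ?_)
      refine hX.generator.nonneg t ht u w ?_
      rintro rfl
      exact hxy (hu.symm.trans (Finset.mem_filter.1 hw).2)
    · have := jointProb_eq_zero_of_ne (μ := μ) (X := X) (A := Set.univ) (t := t) hu
      rw [Set.univ_inter] at this
      rw [this, zero_mul]
  diagonal _ ht x := projectedGenerator_diagonal hX.generator ht x

/-- Sum the forward equation of `X`, on the event `X^i_s = x`, over a fibre. That event is in the
history of `X^i` at every `r ≥ s`, so for almost every `r` the integrand may be rewritten with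
projected rates. -/
theorem WeaklyConsistent.isMarkovChainWithGenerator (hX : IsMarkovChainWithGenerator μ X L)
    (hW : WeaklyConsistent μ X i) :
    IsMarkovChainWithGenerator μ (component X i) (projectedGenerator μ X L i) where
  measurable t ht := measurable_component (hX.measurable t ht) i
  cadlag := hX.cadlag.component i
  markov := hW
  generator := isGeneratorFunction_projectedGenerator hX i
  kolmogorov s t hs hst x y hx := by
    have hV (t : ℝ) (ht : 0 ≤ t) : Measurable (component X i t) :=
      measurable_component (hX.measurable t ht) i
    set B : Set Ω := {ω | component X i s ω = x} with hBdef
    have hB {r : ℝ} (hr : s ≤ r) : MeasurableSet[history (component X i) r] B :=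
      measurableSet_state (measurable_history_of_le hs hr) x
    have hB0 : MeasurableSet B := history_le hV s _ (hB le_rfl)
    have hμ : μ.real B ≠ 0 := (measureReal_ne_zero_iff).2 hx
    have h1 : jointProb μ (component X i) B s y = μ.real B * (1 : Matrix (S i) (S i) ℝ) x y := by
      rcases eq_or_ne x y with rfl | hxy
      · rw [jointProb, ← hBdef, Set.inter_self, Matrix.one_apply_eq, mul_one]
      · rw [Matrix.one_apply_ne hxy, mul_zero, jointProb]
        convert measureReal_empty (μ := μ)
        ext ω
        simp only [hBdef, Set.mem_inter_iff, Set.mem_ofPred_eq, Set.mem_empty_iff_false, iff_false]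
        rintro ⟨rfl, rfl⟩
        exact hxy rfl
    have h2 : jointProb μ (component X i) B t y = jointProb μ (component X i) B s y +
        ∫ r in s..t, ∑ u, jointProb μ X B r u * componentRate L i r u y := by
      rw [jointProb_component (hX.measurable t (hs.trans hst)),
        jointProb_component (hX.measurable s hs), Finset.sum_congr rfl fun w _ =>
        hX.jointProb_eq_add_integral hs hst (history_component_le X i s _ (hB le_rfl)) w,
        Finset.sum_add_distrib, ← intervalIntegral.integral_finsetSum]
      · simp only [componentRate, Finset.mul_sum]
        congr 1
        refine intervalIntegral.integral_congr fun r _ => ?_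
        exact Finset.sum_comm
      · intro w _
        simpa only [Finset.sum_fn] using IntervalIntegrable.sum Finset.univ fun u _ =>
          hX.intervalIntegrable_jointProb_mul hB0 hs hst u w
    have h3 : ∫ r in s..t, ∑ u, jointProb μ X B r u * componentRate L i r u y =
        ∫ r in s..t, ∑ v, jointProb μ (component X i) B r v *
          projectedGenerator μ X L i r v y := by
      refine intervalIntegral.integral_congr_ae ?_
      filter_upwards [hX.generator.ae_isRightLebesguePoint] with r hLr hr
      rw [Set.uIoc_of_le hst] at hr
      have hr0 : 0 ≤ r := hs.trans hr.1.le
      have h4 (v : S i) := hW.sum_jointProb_mul_componentRate hX hr0 hLr (hB hr.1.le) v y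
      have h5 (v : S i) : jointProb μ (component X i) B r v = μ.real
        (B ∩ {ω | component X i r ω = v}) := rfl
      simp only [h5, ← h4]
      rw [Finset.sum_comm]
      refine Finset.sum_congr rfl fun u _ => ?_
      -- A full state `u` is compatible with exactly one state of the component.
      rw [Finset.sum_eq_single (u i)]
      · congr 1
        unfold jointProb
        congr 1
        ext ω
        simp only [component, Set.mem_inter_iff, Set.mem_ofPred_eq]
        exact ⟨fun h => ⟨⟨h.1, congrFun h.2 i⟩, h.2⟩, fun h => ⟨h.1.1, h.2⟩⟩
      · intro v _ hv
        rw [jointProb_eq_zero_of_ne hv.symm, zero_mul]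
      · simp
    rw [transProb_eq hV hs, ← hBdef, h2, h3, h1, mul_add, inv_mul_cancel_left₀ hμ,
      ← intervalIntegral.integral_const_mul]
    simp only [transProb_eq hV hs, ← hBdef, Finset.mul_sum, mul_assoc]

/-- Every generator of the `i`-th component is almost everywhere the projected one. -/
theorem IsMarkovChainWithGenerator.ae_operatorIdentity (hX : IsMarkovChainWithGenerator μ X L)
    {Li : ℝ → Matrix (S i) (S i) ℝ}
    (hLi : IsMarkovChainWithGenerator μ (MarkovConsistency.component X i) Li) :
    ∀ᵐ t ∂(volume.restrict (Set.Ici (0 : ℝ))), OperatorIdentity μ X L i Li t := by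
  filter_upwards [ae_restrict_of_ae hX.generator.ae_isRightLebesguePoint,
    ae_restrict_of_ae hLi.generator.ae_isRightLebesguePoint,
    ae_restrict_mem measurableSet_Ici] with t hLt hLit ht
  rw [operatorIdentity_iff (hX.measurable t ht)]
  intro x y hx
  have hB : MeasurableSet[history (component X i) t] {ω | component X i t ω = x} :=
    measurableSet_state (measurable_history ht) x
  -- The same right derivative, computed once from the forward equation of `X` and once from that of
  -- `X^i`.
  have h1 := (uniqueDiffWithinAt_Ici t).eq_deriv _
    (hX.hasDerivWithinAt_jointProb_component ht hLt (history_component_le X i t _ hB) y)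
    (hLi.hasDerivWithinAt_jointProb ht hLit hB y)
  rw [projectedGenerator, h1, Finset.sum_eq_single x]
  · rw [jointProb, Set.inter_self, inv_mul_cancel_left₀ ((measureReal_ne_zero_iff).2 hx)]
  · intro v _ hv
    have : {ω | component X i t ω = x} ∩ {ω | component X i t ω = v} = ∅ := by
      ext ω
      simp only [Set.mem_inter_iff, Set.mem_ofPred_eq, Set.mem_empty_iff_false, iff_false]
      rintro ⟨rfl, rfl⟩
      exact hv rfl
    rw [jointProb, this, measureReal_empty, zero_mul]
  · simp

end Consistency

end MarkovConsistency

end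

theorem theorem1p3 {Ω : Type*} [MeasurableSpace Ω] (μ : Measure Ω) [IsProbabilityMeasure μ]
    {S : Fin 2 → Type*} [∀ k, Fintype (S k)] [∀ k, DecidableEq (S k)]
    [∀ k, MeasurableSpace (S k)] [∀ k, MeasurableSingletonClass (S k)]
    (X : ℝ → Ω → (∀ k, S k)) (L : ℝ → Matrix (∀ k, S k) (∀ k, S k) ℝ)
    (hX : MarkovConsistency.IsMarkovChainWithGenerator μ X L) (i : Fin 2) :
    (MarkovConsistency.WeaklyConsistent μ X i →
      (∃ Li : ℝ → Matrix (S i) (S i) ℝ,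
        MarkovConsistency.IsMarkovChainWithGenerator μ (MarkovConsistency.component X i) Li ∧
        MarkovConsistency.HistoryIntensity μ X L i Li ∧
        ∀ t : ℝ, 0 ≤ t → MarkovConsistency.OperatorIdentity μ X L i Li t) ∧
      (∀ Li : ℝ → Matrix (S i) (S i) ℝ, MarkovConsistency.HasGeneratorDiagonal Li →
        MarkovConsistency.HistoryIntensity μ X L i Li →
        ∀ᵐ t ∂(volume.restrict (Set.Ici (0 : ℝ))),
          MarkovConsistency.OperatorIdentity μ X L i Li t) ∧
      (∀ Li : ℝ → Matrix (S i) (S i) ℝ,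
        MarkovConsistency.IsMarkovChainWithGenerator μ (MarkovConsistency.component X i) Li →
        ∀ᵐ t ∂(volume.restrict (Set.Ici (0 : ℝ))),
          MarkovConsistency.OperatorIdentity μ X L i Li t)) ∧
    (∀ Li : ℝ → Matrix (S i) (S i) ℝ, MarkovConsistency.HasGeneratorDiagonal Li →
      (MarkovConsistency.StateIntensity μ X L i Li ↔
        ∀ᵐ t ∂(volume.restrict (Set.Ici (0 : ℝ))),
          MarkovConsistency.OperatorIdentity μ X L i Li t)) := by
  have hm := hX.measurable
  have hg := hX.generator
  refine ⟨fun hW => ⟨⟨_, hW.isMarkovChainWithGenerator hX, hW.historyIntensity hX,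
    fun t ht => (MarkovConsistency.operatorIdentity_iff (hm t ht) _).2 fun _ _ _ => rfl⟩,
    fun Li hd hh => (MarkovConsistency.stateIntensity_iff hm hg hd).1 (hh.stateIntensity hm),
    fun Li hLi => hX.ae_operatorIdentity hLi⟩,
    fun Li hd => MarkovConsistency.stateIntensity_iff hm hg hd⟩
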